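/- For a finite set $S$ of points in the Euclidean plane, let $a_S$ be the number of distinct orderings of $S$ by distance from a vantage point $V$, as $V$ ranges over the points of the plane that are not equidistant from two different points of $S$. (Equivalently, $a_S$ is the number of regions into which the perpendicular bisectors of the pairs of points of $S$ divide the plane.) Let $S$ and $T$ be finite point sets in the plane with $|S|=s$ and $|T|=t$, placed freely together, that is: 1. $S\cap T=\emptyset$; 2. (no new parallels) if $e\neq f$ are unordered pairs of different points of $S\cup T$, not both contained in $S$ and not both contained in $T$, then the perpendicular bisectors of $e$ and $f$ are neither parallel nor equal; 3. (no new incidences) if $e,f,g$ are three different unordered pairs of different points of $S\cup T$, not all contained in $S$ and not all contained in $T$, and the perpendicular bisectors of $e,f,g$ have a common point, then $e,f,g$ are the three sides $\{p,q\},\{q,r\},\{p,r\}$ of a triangle. Then $$a_{S\cup T}=a_S+a_T+\frac14\left(3s^2t^2+2s^3t-5s^2t+2st^3-5st^2+7st-4\right).$$ (Parallels and incidences among the bisectors within $S$, or within $T$, are allowed. But bisectors are counted by the pairs that determine them, so when $S$ and $T$ are nonempty, condition 3 together with condition 2 excludes that two different pairs in $S$, or two different pairs in $T$, have the same bisector.)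 -/

import Mathlib

open scoped Affine

/-- The Euclidean plane. -/
abbrev Plane : Type := EuclideanSpace ℝ (Fin 2)

/-- The vantage point `V` generates an ordering of `S` when it has no ties, that is, when it is at
different distances from different points of `S` (it lies on no perpendicular bisector). -/
def NoTies (S : Set Plane) (V : Plane) : Prop :=
  Set.InjOn (fun p => dist V p) S

/-- The ordering of `S` by distance from `V`, as a relation on `S`: `p` comes before `q` when `p` is
closer to `V` than `q`. -/
def distOrder (S : Set Plane) (V : Plane) : S → S → Prop :=
  fun p q => dist V (p : Plane) < dist V (q : Plane)

/-- The orderings of `S` that are generated as the vantage point moves through the plane. -/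
def orderings (S : Set Plane) : Set (S → S → Prop) :=
  {r | ∃ V : Plane, NoTies S V ∧ r = distOrder S V}

/-- The number `a_S` of distinct orderings of `S` (used for finite `S`, where there are only finitely
many relations on `S`). -/
noncomputable def numOrderings (S : Set Plane) : ℕ :=
  (orderings S).ncard

/-- The unordered pairs of two different points of `S`. -/
def pairs (S : Set Plane) : Set (Sym2 Plane) :=
  {e | ¬ e.IsDiag ∧ ∀ p ∈ e, p ∈ S}

/-- The perpendicular bisector of an unordered pair of points. -/
noncomputable def bisector : Sym2 Plane → AffineSubspace ℝ Plane :=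
  Sym2.lift ⟨fun p q => AffineSubspace.perpBisector p q,
    fun _ _ => AffineSubspace.perpBisector_comm _ _⟩

/-- Three pairs that are the three sides of a triangle. Their bisectors always meet in the
circumcenter if the triangle is not degenerate. -/
def AreSides (e f g : Sym2 Plane) : Prop :=
  ∃ p q r : Plane, e = s(p, q) ∧ f = s(q, r) ∧ g = s(p, r)

/-- `S` and `T` are placed freely together: they are disjoint, and `S ∪ T` has no parallels and no
incidences among bisectors apart from those within `S`, those within `T`, and the unavoidable
concurrence of the three bisectors of a triangle. Bisectors are counted by the pairs that
determine them, and equal lines count as parallel. -/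
structure PlacedFreely (S T : Set Plane) : Prop where
  disjoint : Disjoint S T
  no_new_parallel : ∀ e ∈ pairs (S ∪ T), ∀ f ∈ pairs (S ∪ T), e ≠ f →
    ¬ (e ∈ pairs S ∧ f ∈ pairs S) → ¬ (e ∈ pairs T ∧ f ∈ pairs T) →
    ¬ (bisector e ∥ bisector f)
  no_new_incidence : ∀ e ∈ pairs (S ∪ T), ∀ f ∈ pairs (S ∪ T), ∀ g ∈ pairs (S ∪ T),
    e ≠ f → f ≠ g → e ≠ g →
    ¬ (e ∈ pairs S ∧ f ∈ pairs S ∧ g ∈ pairs S) →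
    ¬ (e ∈ pairs T ∧ f ∈ pairs T ∧ g ∈ pairs T) →
    (∃ V : Plane, V ∈ bisector e ∧ V ∈ bisector f ∧ V ∈ bisector g) → AreSides e f g

/-! An ordering of `S` records, for every pair of points, on which side of its bisector the vantage
point lies. So orderings are sign patterns of affine functions (`numOrderings_eq_numRegions`), and
these can be counted by adding one line at a time: a new line creates one region more than the
number of distinct points in which it meets the earlier lines (`numRegions_insert`).

Begin with the bisectors within `S` and within `T`. Each bisector of `S` crosses each bisector of
`T` in a point of its own, which gives $a_S+a_T-1+\binom s2\binom t2$ regions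
(`numRegions_union_pairs`).

Then add the $st$ mixed bisectors. Each meets all bisectors within `S` and within `T` in different
points. An earlier mixed bisector that shares an endpoint with it adds no point: the two meet where
a bisector within `S` or `T` already passes, at a circumcenter. An earlier mixed bisector with
disjoint endpoints adds exactly one point (`ncard_crossings_mixed`). There are $st(s-1)(t-1)/2$
unordered couples of disjoint mixed pairs, so this stage adds $st\left(\binom s2+\binom
t2+1\right)+st(s-1)(t-1)/2$ regions. -/

/-! ### Deletion and restriction for sign patterns of affine functions -/

/-- The sign patterns that the functions `φ i`, `i ∈ F`, realize at the points of `X` where none of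
them vanishes; a pattern is recorded by the set of indices with a positive value. -/
def signPatterns {ι E : Type*} (φ : ι → E → ℝ) (F : Set ι) (X : Set E) : Set (Set ι) :=
  {P | ∃ V ∈ X, (∀ i ∈ F, φ i V ≠ 0) ∧ P = {i | i ∈ F ∧ 0 < φ i V}}

section SignPatterns

variable {ι E : Type*}

theorem signPatterns_finite (φ : ι → E → ℝ) {F : Set ι} (hF : F.Finite) (X : Set E) :
    (signPatterns φ F X).Finite := by
  refine hF.powerset.subset ?_
  rintro P ⟨V, -, -, rfl⟩
  exact fun i hi => hi.1

theorem signPatterns_comp {E' : Type*} (φ : ι → E → ℝ) (F : Set ι) (γ : E' → E) :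
    signPatterns (fun i => φ i ∘ γ) F Set.univ = signPatterns φ F (Set.range γ) := by
  ext P
  constructor
  · rintro ⟨t, -, h, rfl⟩
    exact ⟨γ t, ⟨t, rfl⟩, h, rfl⟩
  · rintro ⟨_, ⟨t, rfl⟩, h, rfl⟩
    exact ⟨t, trivial, h, rfl⟩

theorem pattern_congr {φ : ι → E → ℝ} {F : Set ι} {V W : E}
    (h : ∀ i ∈ F, 0 < φ i V * φ i W) :
    {i | i ∈ F ∧ 0 < φ i V} = {i | i ∈ F ∧ 0 < φ i W} := by
  ext i
  change i ∈ F ∧ 0 < φ i V ↔ i ∈ F ∧ 0 < φ i W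
  refine and_congr_right fun hi => ?_
  rcases pos_and_pos_or_neg_and_neg_of_mul_pos (h i hi) with h | h
  · exact iff_of_true h.1 h.2
  · exact iff_of_false h.1.not_gt h.2.not_gt

theorem mul_pos_of_pattern_eq {φ : ι → E → ℝ} {F : Set ι} {V W : E}
    (hV : ∀ i ∈ F, φ i V ≠ 0) (hW : ∀ i ∈ F, φ i W ≠ 0)
    (h : {i | i ∈ F ∧ 0 < φ i V} = {i | i ∈ F ∧ 0 < φ i W}) :
    ∀ i ∈ F, 0 < φ i V * φ i W := by
  intro i hi
  have h1 : (0 < φ i V) ↔ 0 < φ i W := by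
    have : i ∈ F ∧ 0 < φ i V ↔ i ∈ F ∧ 0 < φ i W := Set.ext_iff.1 h i
    simpa [hi] using this
  rcases lt_or_gt_of_ne (hV i hi) with h2 | h2
  · have h3 : φ i W < 0 := lt_of_le_of_ne (not_lt.1 fun h => (h1.2 h).not_gt h2) (hW i hi)
    exact mul_pos_of_neg_of_neg h2 h3
  · exact mul_pos h2 (h1.1 h2)

theorem ne_zero_of_mul_pos {F : Set ι} {φ : ι → E → ℝ} {V W : E}
    (h : ∀ i ∈ F, 0 < φ i V * φ i W) : ∀ i ∈ F, φ i W ≠ 0 :=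
  fun i hi => right_ne_zero_of_mul (h i hi).ne'

theorem ncard_signPatterns_empty [Nonempty E] (φ : ι → E → ℝ) :
    (signPatterns φ ∅ Set.univ).ncard = 1 := by
  rw [Set.ncard_eq_one]
  refine ⟨∅, ?_⟩
  ext P
  simp [signPatterns]

variable [AddCommGroup E] [Module ℝ E]

/-- Moving a little from `V` towards `W` keeps the signs of finitely many affine functions. -/
theorem eventually_sign_lineMap (φ : ι → E →ᵃ[ℝ] ℝ) {F : Set ι} (hF : F.Finite) (V W : E)
    (hV : ∀ i ∈ F, φ i V ≠ 0) :
    ∀ᶠ t : ℝ in nhds 0, ∀ i ∈ F, 0 < φ i V * φ i (AffineMap.lineMap V W t) := by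
  rw [Filter.eventually_all_finite hF]
  intro i hi
  have hc : Continuous fun t : ℝ => φ i V * φ i (AffineMap.lineMap V W t) := by
    simp only [AffineMap.apply_lineMap, AffineMap.lineMap_apply_ring']
    fun_prop
  refine hc.continuousAt.eventually (lt_mem_nhds ?_)
  simpa using mul_self_pos.2 (hV i hi)

/-- A sign pattern of `F` can be realized off the zeros of `g`; on the zeros of `g` it can be pushed
to both sides. -/
theorem exists_sign_push (φ : ι → E →ᵃ[ℝ] ℝ) {F : Set ι} (hF : F.Finite) {V W : E}
    (hV : ∀ i ∈ F, φ i V ≠ 0) (g : ι) (hg : φ g V = 0) (hW : φ g W ≠ 0) (b : Bool) :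
    ∃ V', (∀ i ∈ F, 0 < φ i V * φ i V') ∧ (if b then 0 < φ g V' else φ g V' < 0) := by
  have h := eventually_sign_lineMap φ hF V W hV
  obtain ⟨ε, hε, h⟩ := Metric.eventually_nhds_iff.1 h
  have key : ∀ t : ℝ, φ g (AffineMap.lineMap V W t) = t * φ g W := fun t => by
    rw [AffineMap.apply_lineMap, hg, AffineMap.lineMap_apply_ring']; ring
  have hp : dist (ε / 2) 0 < ε := by rw [Real.dist_0_eq_abs, abs_of_pos] <;> linarith
  have hn : dist (-(ε / 2)) 0 < ε := by rw [Real.dist_0_eq_abs, abs_neg, abs_of_pos] <;> linarith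
  -- On the line from `V` to `W` the value of `φ g` is `t * φ g W`, so stepping by `ε / 2` towards
  -- or away from `W` produces either sign.
  rcases lt_or_gt_of_ne hW with h1 | h1 <;> cases b
  · exact ⟨_, h hp, by simp only [key]; simpa using mul_neg_of_pos_of_neg (half_pos hε) h1⟩
  · exact ⟨_, h hn, by
      simp only [key]; simpa using mul_neg_of_pos_of_neg (half_pos hε) h1⟩
  · exact ⟨_, h hn, by simp only [key]; simpa using mul_pos (half_pos hε) h1⟩
  · exact ⟨_, h hp, by simp only [key]; simpa using mul_pos (half_pos hε) h1⟩

/-- Deletion and restriction for sign patterns of affine functions. -/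
theorem ncard_signPatterns_insert (φ : ι → E →ᵃ[ℝ] ℝ) {F : Set ι} (hF : F.Finite) {g : ι}
    (hgF : g ∉ F) {W : E} (hW : φ g W ≠ 0) :
    (signPatterns (fun i => φ i) (insert g F) Set.univ).ncard =
      (signPatterns (fun i => φ i) F Set.univ).ncard +
        (signPatterns (fun i => φ i) F {V | φ g V = 0}).ncard := by
  set R := signPatterns (fun i => φ i) (insert g F) Set.univ with hR
  set Rn := signPatterns (fun i => φ i) F {V | φ g V < 0} with hRn
  set Rp := signPatterns (fun i => φ i) F {V | 0 < φ g V} with hRp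
  have hfn : Rn.Finite := signPatterns_finite _ hF _
  have hfp : Rp.Finite := signPatterns_finite _ hF _
  have hnot : ∀ X, ∀ P ∈ signPatterns (fun i => φ i) F X, g ∉ P := by
    rintro X P ⟨V, -, -, rfl⟩ h
    exact hgF h.1
  -- Patterns of the larger family split by the sign at `g`. Hence they number `Rn.ncard +
  -- Rp.ncard`, whereas the patterns of `F` are `Rn ∪ Rp`; the excess is the intersection, which
  -- consists of the patterns that occur on the zero set of `g`.
  have h1 : R = Rn ∪ (insert g) '' Rp := by
    ext P
    constructor
    · rintro ⟨V, -, h, rfl⟩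
      have hF' : ∀ i ∈ F, φ i V ≠ 0 := fun i hi => h i (Set.mem_insert_of_mem _ hi)
      rcases lt_or_gt_of_ne (h g (Set.mem_insert _ _)) with hg | hg
      · refine Or.inl ⟨V, hg, hF', ?_⟩
        ext i
        simp only [Set.mem_insert_iff, Set.mem_ofPred_eq]
        constructor
        · rintro ⟨rfl | h, h'⟩
          · exact absurd h' hg.not_gt
          · exact ⟨h, h'⟩
        · exact fun h => ⟨Or.inr h.1, h.2⟩
      · refine Or.inr ⟨_, ⟨V, hg, hF', rfl⟩, ?_⟩
        ext i
        simp only [Set.mem_insert_iff, Set.mem_ofPred_eq]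
        constructor
        · rintro (rfl | h)
          · exact ⟨Or.inl rfl, hg⟩
          · exact ⟨Or.inr h.1, h.2⟩
        · rintro ⟨rfl | h, h'⟩
          · exact Or.inl rfl
          · exact Or.inr ⟨h, h'⟩
    · rintro (⟨V, hg, h, rfl⟩ | ⟨_, ⟨V, hg, h, rfl⟩, rfl⟩)
      · refine ⟨V, trivial, ?_, ?_⟩
        · rintro i (rfl | hi)
          · exact ne_of_lt hg
          · exact h i hi
        · ext i
          simp only [Set.mem_insert_iff, Set.mem_ofPred_eq]
          constructor
          · exact fun h => ⟨Or.inr h.1, h.2⟩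
          · rintro ⟨rfl | h, h'⟩
            · exact absurd h' (not_lt.2 (le_of_lt hg))
            · exact ⟨h, h'⟩
      · refine ⟨V, trivial, ?_, ?_⟩
        · rintro i (rfl | hi)
          · exact ne_of_gt hg
          · exact h i hi
        · ext i
          simp only [Set.mem_insert_iff, Set.mem_ofPred_eq]
          constructor
          · rintro (rfl | h)
            · exact ⟨Or.inl rfl, hg⟩
            · exact ⟨Or.inr h.1, h.2⟩
          · rintro ⟨rfl | h, h'⟩
            · exact Or.inl rfl
            · exact Or.inr ⟨h, h'⟩
  have h2 : R.ncard = Rn.ncard + Rp.ncard := by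
    rw [h1, Set.ncard_union_eq _ hfn (hfp.image _), Set.InjOn.ncard_image]
    · intro P hP Q hQ h
      have hP' := hnot _ _ hP
      have hQ' := hnot _ _ hQ
      ext i
      have := Set.ext_iff.1 h i
      simp only [Set.mem_insert_iff] at this
      by_cases hi : i = g
      · subst hi; simp [hP', hQ']
      · simpa [hi] using this
    · rw [Set.disjoint_left]
      rintro P hP ⟨Q, -, rfl⟩
      exact hnot _ _ hP (Set.mem_insert _ _)
  have h3 : Rn ∪ Rp = signPatterns (fun i => φ i) F Set.univ := by
    ext P
    constructor
    · rintro (⟨V, -, h⟩ | ⟨V, -, h⟩) <;> exact ⟨V, trivial, h⟩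
    · rintro ⟨V, -, h, rfl⟩
      rcases lt_trichotomy (φ g V) 0 with hg | hg | hg
      · exact Or.inl ⟨V, hg, h, rfl⟩
      · obtain ⟨V', hV', hg'⟩ := exists_sign_push φ hF h g hg hW true
        exact Or.inr ⟨V', by simpa using hg', ne_zero_of_mul_pos (φ := fun i => φ i) hV',
          pattern_congr (φ := fun i => φ i) hV'⟩
      · exact Or.inr ⟨V, hg, h, rfl⟩
  have h4 : Rn ∩ Rp = signPatterns (fun i => φ i) F {V | φ g V = 0} := by
    ext P
    constructor
    · rintro ⟨⟨V, hgV, hV, rfl⟩, ⟨U, hgU, hU, hP⟩⟩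
      have hmul := mul_pos_of_pattern_eq (φ := fun i => φ i) hV hU hP
      simp only [Set.mem_ofPred_eq] at hgV hgU
      -- The parameter at which the segment from `V` to `U` crosses the zero set of `φ g`. By
      -- convexity the common signs at the two ends persist there.
      set t := -φ g V / (φ g U - φ g V) with ht
      have hpos : 0 < φ g U - φ g V := by linarith
      have ht0 : 0 ≤ t := div_nonneg (by linarith) hpos.le
      have ht1 : t ≤ 1 := by rw [ht, div_le_one hpos]; linarith
      have hsign : ∀ i ∈ F, 0 < φ i V * φ i (AffineMap.lineMap V U t) := by
        intro i hi
        have h5 := hmul i hi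
        have h6 := mul_self_pos.2 (hV i hi)
        rw [AffineMap.apply_lineMap, AffineMap.lineMap_apply_ring]
        have h7 : φ i V * ((1 - t) * φ i V + t * φ i U) =
          (1 - t) * (φ i V * φ i V) + t * (φ i V * φ i U) := by ring
        rw [h7]
        rcases eq_or_lt_of_le ht0 with h8 | h8
        · rw [← h8]; simpa using hV i hi
        · exact add_pos_of_nonneg_of_pos (mul_nonneg (by linarith) h6.le) (mul_pos h8 h5)
      refine ⟨AffineMap.lineMap V U t, ?_, ne_zero_of_mul_pos (φ := fun i => φ i) hsign,
        pattern_congr (φ := fun i => φ i) hsign⟩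
      simp only [Set.mem_ofPred_eq]
      rw [AffineMap.apply_lineMap, AffineMap.lineMap_apply_ring', ht]
      field_simp
      ring
    · rintro ⟨V, hg, h, rfl⟩
      obtain ⟨V', hV', hg'⟩ := exists_sign_push φ hF h g hg hW true
      obtain ⟨U', hU', hgU'⟩ := exists_sign_push φ hF h g hg hW false
      exact ⟨⟨U', by simpa using hgU', ne_zero_of_mul_pos (φ := fun i => φ i) hU',
          pattern_congr (φ := fun i => φ i) hU'⟩,
        ⟨V', by simpa using hg', ne_zero_of_mul_pos (φ := fun i => φ i) hV',
          pattern_congr (φ := fun i => φ i) hV'⟩⟩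
  rw [h2, ← h3, ← h4, Set.ncard_union_add_ncard_inter _ _ hfn hfp]

/-! ### Counting pieces on a line and regions in a plane -/

theorem subsingleton_zeros_real {f : ℝ →ᵃ[ℝ] ℝ} {w : ℝ} (hw : f w ≠ 0) :
    {t | f t = 0}.Subsingleton := by
  intro a ha b hb
  by_contra hab
  apply hw
  have hba : b - a ≠ 0 := sub_ne_zero.2 (Ne.symm hab)
  have : w = AffineMap.lineMap a b ((w - a) / (b - a)) := by
    rw [AffineMap.lineMap_apply_ring']; field_simp; ring
  rw [this, AffineMap.apply_lineMap, ha, hb]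
  simp

theorem finite_zeros_real (ψ : ι → ℝ →ᵃ[ℝ] ℝ) {F : Set ι} (hF : F.Finite)
    (h : ∀ i ∈ F, ∃ w, ψ i w ≠ 0) : {t | ∃ i ∈ F, ψ i t = 0}.Finite := by
  have : {t | ∃ i ∈ F, ψ i t = 0} = ⋃ i ∈ F, {t | ψ i t = 0} := by ext; simp
  rw [this]
  exact hF.biUnion fun i hi => (subsingleton_zeros_real (h i hi).choose_spec).finite

/-- Finitely many affine functions on the real line cut it into one piece more than they have
zeros. -/
theorem ncard_signPatterns_real (ψ : ι → ℝ →ᵃ[ℝ] ℝ) {F : Set ι} (hF : F.Finite)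
    (h : ∀ i ∈ F, ∃ w, ψ i w ≠ 0) :
    (signPatterns (fun i => ψ i) F Set.univ).ncard = {t | ∃ i ∈ F, ψ i t = 0}.ncard + 1 := by
  induction F, hF using Set.Finite.induction_on with
  | empty => rw [ncard_signPatterns_empty]; simp
  | @insert g F hgF hF ih =>
    have h' : ∀ i ∈ F, ∃ w, ψ i w ≠ 0 := fun i hi => h i (Set.mem_insert_of_mem _ hi)
    obtain ⟨w, hw⟩ := h g (Set.mem_insert _ _)
    rw [ncard_signPatterns_insert ψ hF hgF hw, ih h']
    have hsub := subsingleton_zeros_real hw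
    have hun : {t | ∃ i ∈ insert g F, ψ i t = 0} =
        {t | ψ g t = 0} ∪ {t | ∃ i ∈ F, ψ i t = 0} := by
      ext; simp
    have hfin := finite_zeros_real ψ hF h'
    rw [hun]
    -- A zero of `ψ g` that is not yet a zero of the family contributes the single pattern seen at
    -- that point; otherwise both counts stay unchanged.
    by_cases hz : ∃ t, ψ g t = 0 ∧ ∀ i ∈ F, ψ i t ≠ 0
    · obtain ⟨t, ht, htF⟩ := hz
      have h1 : {t | ψ g t = 0} = {t} := hsub.eq_singleton_of_mem ht
      rw [h1]
      have h2 : signPatterns (fun i => ψ i) F {t} = {{i | i ∈ F ∧ 0 < ψ i t}} := by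
        ext P
        simp only [signPatterns, Set.mem_singleton_iff, exists_eq_left, Set.mem_ofPred_eq]
        exact ⟨fun h => h.2, fun h => ⟨htF, h⟩⟩
      rw [h2, Set.ncard_singleton, Set.singleton_union, Set.ncard_insert_of_notMem _ hfin]
      rintro ⟨i, hi, h⟩
      exact htF i hi h
    · push Not at hz
      have h2 : signPatterns (fun i => ψ i) F {t | ψ g t = 0} = ∅ := by
        rw [Set.eq_empty_iff_forall_notMem]
        rintro P ⟨t, ht, h, -⟩
        obtain ⟨i, hi, h0⟩ := hz t ht
        exact h i hi h0
      have h3 : {t | ψ g t = 0} ⊆ {t | ∃ i ∈ F, ψ i t = 0} := fun t ht => hz t ht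
      rw [h2, Set.union_eq_self_of_subset_left h3]
      simp

/-- The zero set of a nonconstant affine function on a plane is parametrized by the real line. -/
theorem exists_param_zeros (hE : Module.finrank ℝ E = 2) (f : E →ᵃ[ℝ] ℝ) (hf : f.linear ≠ 0) :
    ∃ γ : ℝ →ᵃ[ℝ] E, Function.Injective γ ∧ Set.range γ = {V | f V = 0} := by
  have : FiniteDimensional ℝ E := Module.finite_of_finrank_pos (by omega)
  have hk : Module.finrank ℝ (LinearMap.ker f.linear) = 1 := by
    have := Module.Dual.finrank_ker_add_one_of_ne_zero (f := f.linear) hf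
    omega
  obtain ⟨v, hv0, hv⟩ := finrank_eq_one_iff'.1 hk
  obtain ⟨c, hc⟩ : ∃ c, f c = 0 := by
    obtain ⟨u, hu⟩ := LinearMap.surjective hf (-f 0)
    refine ⟨u, ?_⟩
    have := f.map_vadd 0 u
    simpa [hu] using this
  have hv' : f.linear v = 0 := v.2
  refine ⟨AffineMap.lineMap c ((v : E) + c), ?_, ?_⟩
  · apply AffineMap.lineMap_injective
    intro h
    apply hv0
    ext
    simpa using h.symm
  · ext V
    constructor
    · rintro ⟨t, rfl⟩
      have : f ((v : E) + c) = 0 := by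
        have := f.map_vadd c (v : E)
        simpa [hv', hc] using this
      simp [AffineMap.apply_lineMap, hc, this]
    · intro hV
      have hmem : V - c ∈ LinearMap.ker f.linear := by
        rw [LinearMap.mem_ker]
        have := f.linearMap_vsub V c
        simp only [vsub_eq_sub] at this
        have hV0 : f V = 0 := hV
        rw [this, hc, hV0, sub_zero]
      obtain ⟨t, ht⟩ := hv ⟨V - c, hmem⟩
      refine ⟨t, ?_⟩
      have ht' : t • (v : E) = V - c := congrArg Subtype.val ht
      rw [AffineMap.lineMap_apply]
      simp [ht']

/-- The points where the zero line of `φ g` meets the zeros of the functions in `F`. -/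
def crossings {ι E : Type*} (φ : ι → E → ℝ) (g : ι) (F : Set ι) : Set E :=
  {V | φ g V = 0 ∧ ∃ i ∈ F, φ i V = 0}

/-- An affine parametrization of the zero line of `φ g` reduces this to the count of pieces of the
real line: crossings become zeros of the pulled-back functions. -/
theorem crossings_finite_and_ncard (hE : Module.finrank ℝ E = 2) (φ : ι → E →ᵃ[ℝ] ℝ) {F : Set ι}
    (hF : F.Finite) {g : ι} (hg : (φ g).linear ≠ 0) (h : ∀ i ∈ F, ∃ V, φ g V = 0 ∧ φ i V ≠ 0) :
    (crossings (fun i => φ i) g F).Finite ∧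
      (signPatterns (fun i => φ i) F {V | φ g V = 0}).ncard =
        (crossings (fun i => φ i) g F).ncard + 1 := by
  obtain ⟨γ, hγ, hr⟩ := exists_param_zeros hE (φ g) hg
  have hne : ∀ i ∈ F, ∃ w, ((φ i).comp γ) w ≠ 0 := by
    intro i hi
    obtain ⟨V, hV, hi⟩ := h i hi
    obtain ⟨w, rfl⟩ : V ∈ Set.range γ := hr ▸ hV
    exact ⟨w, hi⟩
  have himg : crossings (fun i => φ i) g F = γ '' {t | ∃ i ∈ F, ((φ i).comp γ) t = 0} := by
    ext V
    constructor
    · rintro ⟨hV, i, hi, h0⟩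
      obtain ⟨w, rfl⟩ : V ∈ Set.range γ := hr ▸ hV
      exact ⟨w, ⟨i, hi, h0⟩, rfl⟩
    · rintro ⟨w, ⟨i, hi, h0⟩, rfl⟩
      exact ⟨hr.subset ⟨w, rfl⟩, i, hi, h0⟩
  rw [himg, ← hr, Set.ncard_image_of_injective _ hγ,
    ← ncard_signPatterns_real (fun i => (φ i).comp γ) hF hne, ← signPatterns_comp]
  exact ⟨(finite_zeros_real (fun i => (φ i).comp γ) hF hne).image _, rfl⟩

/-- A line that is added to an arrangement in the plane creates one region more than there are points
on it where it meets the arrangement. -/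
theorem ncard_signPatterns_insert_plane (hE : Module.finrank ℝ E = 2) (φ : ι → E →ᵃ[ℝ] ℝ)
    {F : Set ι} (hF : F.Finite) {g : ι} (hgF : g ∉ F) (hg : (φ g).linear ≠ 0)
    (h : ∀ i ∈ F, ∃ V, φ g V = 0 ∧ φ i V ≠ 0) :
    (signPatterns (fun i => φ i) (insert g F) Set.univ).ncard =
      (signPatterns (fun i => φ i) F Set.univ).ncard + (crossings (fun i => φ i) g F).ncard + 1 := by
  obtain ⟨W, hW⟩ : ∃ W, φ g W ≠ 0 := by
    by_contra! hW
    apply hg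
    ext v
    have := (φ g).linearMap_vsub v 0
    simpa [hW] using this
  rw [ncard_signPatterns_insert φ hF hgF hW, (crossings_finite_and_ncard hE φ hF hg h).2, add_assoc]

end SignPatterns

/-! ### Perpendicular bisectors as zero lines -/

/-- The affine function `V ↦ dist V q ^ 2 - dist V p ^ 2`, for the pair `e = {p, q}` in the order
`e.out`. -/
noncomputable def bisectorForm (e : Sym2 Plane) : Plane →ᵃ[ℝ] ℝ :=
  ((2 : ℝ) • innerₛₗ ℝ (e.out.1 - e.out.2)).toAffineMap +
    AffineMap.const ℝ Plane (‖e.out.2‖ ^ 2 - ‖e.out.1‖ ^ 2)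

theorem mk_out (e : Sym2 Plane) : s(e.out.1, e.out.2) = e := e.out_eq

theorem bisectorForm_apply (e : Sym2 Plane) (V : Plane) :
    bisectorForm e V = dist V e.out.2 ^ 2 - dist V e.out.1 ^ 2 := by
  rw [dist_eq_norm, dist_eq_norm, norm_sub_sq_real, norm_sub_sq_real]
  simp only [bisectorForm, AffineMap.coe_add, Pi.add_apply, LinearMap.coe_toAffineMap,
    LinearMap.smul_apply, innerₛₗ_apply_apply, AffineMap.const_apply, smul_eq_mul,
    real_inner_comm V, inner_sub_right]
  ring

theorem bisectorForm_pos_iff (e : Sym2 Plane) (V : Plane) :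
    0 < bisectorForm e V ↔ dist V e.out.1 < dist V e.out.2 := by
  rw [bisectorForm_apply, sub_pos, sq_lt_sq₀ dist_nonneg dist_nonneg]

theorem bisectorForm_eq_zero_iff_dist (e : Sym2 Plane) (V : Plane) :
    bisectorForm e V = 0 ↔ dist V e.out.1 = dist V e.out.2 := by
  rw [bisectorForm_apply, sub_eq_zero, sq_eq_sq₀ dist_nonneg dist_nonneg, eq_comm]

theorem mem_bisector_mk {p q V : Plane} : V ∈ bisector s(p, q) ↔ dist V p = dist V q :=
  AffineSubspace.mem_perpBisector_iff_dist_eq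

theorem bisectorForm_eq_zero_iff {e : Sym2 Plane} {V : Plane} :
    bisectorForm e V = 0 ↔ V ∈ bisector e := by
  rw [bisectorForm_eq_zero_iff_dist]
  conv_rhs => rw [← mk_out e]
  rw [mem_bisector_mk]

theorem out_ne_of_not_isDiag {e : Sym2 Plane} (he : ¬ e.IsDiag) : e.out.1 ≠ e.out.2 := by
  intro h
  apply he
  rw [← mk_out e]
  exact h

theorem bisectorForm_linear_ne_zero {e : Sym2 Plane} (he : ¬ e.IsDiag) :
    (bisectorForm e).linear ≠ 0 := by
  intro h
  have h1 : ∀ v, (bisectorForm e).linear v = 2 * inner ℝ (e.out.1 - e.out.2) v := by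
    simp [bisectorForm, inner_sub_left]
  have h2 := h1 (e.out.1 - e.out.2)
  rw [h, real_inner_self_eq_norm_sq, LinearMap.zero_apply] at h2
  have h3 := norm_pos_iff.2 (sub_ne_zero.2 (out_ne_of_not_isDiag he))
  nlinarith

theorem finrank_plane : Module.finrank ℝ Plane = 2 := by simp

theorem bisector_nonempty (e : Sym2 Plane) : (bisector e : Set Plane).Nonempty := by
  rw [← mk_out e]
  exact AffineSubspace.perpBisector_nonempty

theorem finrank_direction_bisector {e : Sym2 Plane} (he : ¬ e.IsDiag) :
    Module.finrank ℝ (bisector e).direction = 1 := by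
  have : Fact (Module.finrank ℝ Plane = 1 + 1) := ⟨finrank_plane⟩
  rw [← mk_out e]
  change Module.finrank ℝ (AffineSubspace.perpBisector e.out.1 e.out.2).direction = 1
  rw [AffineSubspace.direction_perpBisector]
  exact Submodule.finrank_orthogonal_span_singleton (vsub_ne_zero.2 (out_ne_of_not_isDiag he).symm)

theorem bisector_ne_bot (e : Sym2 Plane) : bisector e ≠ ⊥ :=
  (AffineSubspace.nonempty_iff_ne_bot _).1 (bisector_nonempty e)

theorem bisector_parallel_of_direction_eq {e f : Sym2 Plane}
    (h : (bisector e).direction = (bisector f).direction) : bisector e ∥ bisector f :=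
  AffineSubspace.parallel_iff_direction_eq_and_eq_bot_iff_eq_bot.2
    ⟨h, by simp [bisector_ne_bot]⟩

theorem bisector_inter_eq_singleton {e f : Sym2 Plane} (he : ¬ e.IsDiag) (hf : ¬ f.IsDiag)
    (h : ¬ bisector e ∥ bisector f) : ∃ V, (bisector e : Set Plane) ∩ bisector f = {V} := by
  apply AffineSubspace.inter_eq_singleton_of_nonempty_of_isCompl (bisector_nonempty e)
    (bisector_nonempty f)
  have hae := Submodule.isAtom_iff_finrank_eq_one.2 (finrank_direction_bisector he)
  have haf := Submodule.isAtom_iff_finrank_eq_one.2 (finrank_direction_bisector hf)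
  refine (Submodule.isCompl_iff_disjoint _ _ ?_).2
    (hae.disjoint_of_ne haf fun hd => h (bisector_parallel_of_direction_eq hd))
  rw [finrank_direction_bisector he, finrank_direction_bisector hf, finrank_plane]

/-- Containment of one bisector in the other would make their directions, both of dimension one,
equal. -/
theorem exists_mem_bisector_notMem {e f : Sym2 Plane} (he : ¬ e.IsDiag) (hf : ¬ f.IsDiag)
    (h : ¬ bisector e ∥ bisector f) : ∃ V, V ∈ bisector e ∧ V ∉ bisector f := by
  by_contra! hle
  apply h
  apply bisector_parallel_of_direction_eq
  apply Submodule.eq_of_le_of_finrank_eq (AffineSubspace.direction_le hle)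
  rw [finrank_direction_bisector he, finrank_direction_bisector hf]

/-- The number of regions into which the bisectors of the pairs in `F` divide the plane. -/
noncomputable def numRegions (F : Set (Sym2 Plane)) : ℕ :=
  (signPatterns (fun e => bisectorForm e) F Set.univ).ncard

theorem numRegions_empty : numRegions ∅ = 1 := ncard_signPatterns_empty _

theorem mem_crossings {g : Sym2 Plane} {F : Set (Sym2 Plane)} {V : Plane} :
    V ∈ crossings (fun e => bisectorForm e) g F ↔
      V ∈ bisector g ∧ ∃ e ∈ F, V ∈ bisector e := by
  change bisectorForm g V = 0 ∧ (∃ e ∈ F, bisectorForm e V = 0) ↔ _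
  simp only [bisectorForm_eq_zero_iff]

/-- It suffices that the new line differs from the old ones. Parallels are permitted, as they may
occur within `S` or within `T`. -/
theorem numRegions_insert {F : Set (Sym2 Plane)} (hF : F.Finite) {g : Sym2 Plane} (hgF : g ∉ F)
    (hg : ¬ g.IsDiag) (h : ∀ e ∈ F, ∃ V, V ∈ bisector g ∧ V ∉ bisector e) :
    numRegions (insert g F) =
      numRegions F + (crossings (fun e => bisectorForm e) g F).ncard + 1 := by
  apply ncard_signPatterns_insert_plane finrank_plane _ hF hgF (bisectorForm_linear_ne_zero hg)
  simpa only [bisectorForm_eq_zero_iff, Ne] using h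

theorem crossings_finite {F : Set (Sym2 Plane)} (hF : F.Finite) {g : Sym2 Plane}
    (hg : ¬ g.IsDiag) (h : ∀ e ∈ F, ∃ V, V ∈ bisector g ∧ V ∉ bisector e) :
    (crossings (fun e => bisectorForm e) g F).Finite := by
  apply (crossings_finite_and_ncard finrank_plane _ hF (bisectorForm_linear_ne_zero hg) _).1
  simpa only [bisectorForm_eq_zero_iff, Ne] using h

/-- A line meets as many other lines in different points as there are lines, if it is parallel to
none of them and passes through no intersection point of two of them. -/
theorem ncard_crossings_of_generic {F : Set (Sym2 Plane)} {g : Sym2 Plane}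
    (hg : ¬ g.IsDiag) (hFd : ∀ e ∈ F, ¬ e.IsDiag) (hpar : ∀ e ∈ F, ¬ bisector g ∥ bisector e)
    (hinc : ∀ e ∈ F, ∀ f ∈ F, e ≠ f → ¬ ∃ V, V ∈ bisector g ∧ V ∈ bisector e ∧ V ∈ bisector f) :
    (crossings (fun e => bisectorForm e) g F).ncard = F.ncard := by
  have hex : ∀ e : Sym2 Plane, ∃ V, e ∈ F → (bisector g : Set Plane) ∩ bisector e = {V} := by
    intro e
    by_cases he : e ∈ F
    · obtain ⟨V, hV⟩ := bisector_inter_eq_singleton hg (hFd e he) (hpar e he)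
      exact ⟨V, fun _ => hV⟩
    -- An arbitrary value off `F`, so that the intersection points form a total function.
    · exact ⟨0, fun h => absurd h he⟩
  choose x hx using hex
  have hmem : ∀ e ∈ F, x e ∈ bisector g ∧ x e ∈ bisector e := fun e he => by
    have : x e ∈ (bisector g : Set Plane) ∩ bisector e := by rw [hx e he]; rfl
    exact this
  have himg : crossings (fun e => bisectorForm e) g F = x '' F := by
    ext V
    rw [mem_crossings]
    constructor
    · rintro ⟨hV, e, he, hVe⟩
      have : V ∈ (bisector g : Set Plane) ∩ bisector e := ⟨hV, hVe⟩
      rw [hx e he] at this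
      exact ⟨e, he, this.symm⟩
    · rintro ⟨e, he, rfl⟩
      exact ⟨(hmem e he).1, e, he, (hmem e he).2⟩
  rw [himg, Set.InjOn.ncard_image]
  intro e he f hf hef
  by_contra hne
  exact hinc e he f hf hne ⟨x e, (hmem e he).1, (hmem e he).2, hef ▸ (hmem f hf).2⟩

/-! ### Orderings as sign patterns -/

theorem ncard_image_eq_ncard_image {α β γ : Type*} {X : Set α} {f : α → β} {g : α → γ}
    (h : ∀ x ∈ X, ∀ y ∈ X, f x = f y ↔ g x = g y) : (f '' X).ncard = (g '' X).ncard := by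
  refine Set.ncard_congr (fun b hb => g hb.choose) ?_ ?_ ?_
  · exact fun b hb => ⟨_, hb.choose_spec.1, rfl⟩
  · intro b c hb hc hbc
    rw [← hb.choose_spec.2, ← hc.choose_spec.2]
    exact (h _ hb.choose_spec.1 _ hc.choose_spec.1).2 hbc
  · rintro _ ⟨a, ha, rfl⟩
    have hb : f a ∈ f '' X := ⟨a, ha, rfl⟩
    exact ⟨f a, hb, (h _ hb.choose_spec.1 _ ha).1 hb.choose_spec.2⟩

theorem mk_mem_pairs {S : Set Plane} {p q : Plane} :
    s(p, q) ∈ pairs S ↔ p ≠ q ∧ p ∈ S ∧ q ∈ S := by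
  change (¬ (s(p, q)).IsDiag ∧ ∀ r ∈ s(p, q), r ∈ S) ↔ _
  simp

theorem noTies_iff {S : Set Plane} {V : Plane} :
    NoTies S V ↔ ∀ e ∈ pairs S, bisectorForm e V ≠ 0 := by
  constructor
  · intro h e he h0
    rw [← mk_out e, mk_mem_pairs] at he
    exact he.1 (h he.2.1 he.2.2 ((bisectorForm_eq_zero_iff_dist e V).1 h0))
  · intro h p hp q hq hpq
    by_contra hne
    exact h s(p, q) (mk_mem_pairs.2 ⟨hne, hp, hq⟩)
      (bisectorForm_eq_zero_iff.2 (mem_bisector_mk.2 hpq))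

/-- Both sides count classes of tie-free vantage points, and two such points give the same ordering
exactly when all their pairwise comparisons agree. -/
theorem numOrderings_eq_numRegions (S : Set Plane) : numOrderings S = numRegions (pairs S) := by
  have h1 : orderings S = distOrder S '' {V | NoTies S V} := by
    ext r
    constructor
    · rintro ⟨V, hV, rfl⟩
      exact ⟨V, hV, rfl⟩
    · rintro ⟨V, hV, rfl⟩
      exact ⟨V, hV, rfl⟩
  have h2 : signPatterns (fun e => bisectorForm e) (pairs S) Set.univ =
      (fun V => {e | e ∈ pairs S ∧ 0 < bisectorForm e V}) '' {V | NoTies S V} := by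
    ext P
    constructor
    · rintro ⟨V, -, hV, rfl⟩
      exact ⟨V, noTies_iff.2 hV, rfl⟩
    · rintro ⟨V, hV, rfl⟩
      exact ⟨V, trivial, noTies_iff.1 hV, rfl⟩
  rw [numOrderings, numRegions, h1, h2]
  apply ncard_image_eq_ncard_image
  intro V hV W hW
  constructor
  · intro h
    ext e
    change e ∈ pairs S ∧ 0 < bisectorForm e V ↔ e ∈ pairs S ∧ 0 < bisectorForm e W
    refine and_congr_right fun he => ?_
    rw [← mk_out e, mk_mem_pairs] at he
    rw [bisectorForm_pos_iff, bisectorForm_pos_iff]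
    exact iff_of_eq (congrFun₂ h ⟨_, he.2.1⟩ ⟨_, he.2.2⟩)
  · intro h
    have key : ∀ e ∈ pairs S,
        (dist V e.out.1 < dist V e.out.2 ↔ dist W e.out.1 < dist W e.out.2) := by
      intro e he
      rw [← bisectorForm_pos_iff, ← bisectorForm_pos_iff]
      have h3 : e ∈ pairs S ∧ 0 < bisectorForm e V ↔ e ∈ pairs S ∧ 0 < bisectorForm e W :=
        Set.ext_iff.1 h e
      simpa [he] using h3
    ext ⟨p, hp⟩ ⟨q, hq⟩
    change dist V p < dist V q ↔ dist W p < dist W q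
    by_cases hpq : p = q
    · simp [hpq]
    · have h4 := key s(p, q) (mk_mem_pairs.2 ⟨hpq, hp, hq⟩)
      have h5 := mk_out s(p, q)
      rcases Sym2.eq_iff.1 h5 with ⟨h6, h7⟩ | ⟨h6, h7⟩
      · rwa [h6, h7] at h4
      · rw [h6, h7] at h4
        have hVne : dist V p ≠ dist V q := fun h => hpq (hV hp hq h)
        have hWne : dist W p ≠ dist W q := fun h => hpq (hW hp hq h)
        -- Here `Quot.out` lists the pair in reverse, so the known comparison is of `q` with `p`; in
        -- the absence of ties its negation is the one wanted.
        rw [← hVne.le_iff_lt, ← hWne.le_iff_lt, ← not_lt, ← not_lt]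
        exact not_congr h4

/-! ### Pairs within a union, and sides of triangles -/

section Pairs

variable {S T : Set Plane}

theorem pairs_mono (h : S ⊆ T) : pairs S ⊆ pairs T :=
  fun _ he => ⟨he.1, fun p hp => h (he.2 p hp)⟩

theorem disjoint_pairs (h : Disjoint S T) : Disjoint (pairs S) (pairs T) := by
  rw [Set.disjoint_left]
  intro e hS hT
  exact Set.disjoint_left.1 h (hS.2 _ e.out_fst_mem) (hT.2 _ e.out_fst_mem)

theorem pairs_coe [DecidableEq Plane] (S : Finset Plane) :
    pairs (S : Set Plane) = (S.offDiag.image Sym2.mk.uncurry : Finset (Sym2 Plane)) := by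
  ext e
  induction e with
  | h p q =>
    rw [mk_mem_pairs]
    simp only [Finset.coe_image, Finset.coe_offDiag, Set.mem_image, Set.mem_offDiag, Prod.exists,
      SetLike.mem_coe]
    constructor
    · rintro ⟨hne, hp, hq⟩
      exact ⟨p, q, ⟨hp, hq, hne⟩, rfl⟩
    · rintro ⟨a, b, ⟨ha, hb, hne⟩, h⟩
      rcases Sym2.eq_iff.1 h with ⟨rfl, rfl⟩ | ⟨rfl, rfl⟩
      · exact ⟨hne, ha, hb⟩
      · exact ⟨hne.symm, hb, ha⟩

theorem pairs_finite (hS : S.Finite) : (pairs S).Finite := by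
  classical
  rw [← hS.coe_toFinset, pairs_coe]
  exact Finset.finite_toSet _

theorem ncard_pairs (hS : S.Finite) : (pairs S).ncard = S.ncard.choose 2 := by
  classical
  rw [← hS.coe_toFinset, pairs_coe, Set.ncard_coe_finset, Set.ncard_coe_finset]
  exact Sym2.card_image_offDiag _

/-- The unordered pair formed by the two components. -/
def unorderedPair (x : Plane × Plane) : Sym2 Plane := s(x.1, x.2)

theorem pairs_union (S T : Set Plane) (h : Disjoint S T) :
    pairs (S ∪ T) = pairs S ∪ pairs T ∪ unorderedPair '' (S ×ˢ T) := by
  have hne : ∀ p ∈ S, ∀ q ∈ T, p ≠ q := fun p hp q hq hpq =>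
    Set.disjoint_left.1 h hp (hpq ▸ hq)
  apply Set.Subset.antisymm
  · intro e
    induction e with
    | h p q =>
      rw [mk_mem_pairs]
      rintro ⟨hpq, hp | hp, hq | hq⟩
      · exact Or.inl (Or.inl (mk_mem_pairs.2 ⟨hpq, hp, hq⟩))
      · exact Or.inr ⟨(p, q), ⟨hp, hq⟩, rfl⟩
      · exact Or.inr ⟨(q, p), ⟨hq, hp⟩, Sym2.eq_swap⟩
      · exact Or.inl (Or.inr (mk_mem_pairs.2 ⟨hpq, hp, hq⟩))
  · rintro e ((he | he) | ⟨⟨p, q⟩, ⟨hp, hq⟩, rfl⟩)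
    · exact pairs_mono Set.subset_union_left he
    · exact pairs_mono Set.subset_union_right he
    · exact mk_mem_pairs.2 ⟨hne p hp q hq, Or.inl hp, Or.inr hq⟩

theorem injOn_unorderedPair (h : Disjoint S T) : Set.InjOn unorderedPair (S ×ˢ T) := by
  rintro ⟨p, q⟩ ⟨hp, hq⟩ ⟨p', q'⟩ ⟨hp', hq'⟩ hpq
  rcases Sym2.eq_iff.1 hpq with ⟨h1, h2⟩ | ⟨h1, h2⟩
  · exact Prod.ext h1 h2
  · simp only at h1 hp hq'
    exact absurd (h1 ▸ hq') (Set.disjoint_left.1 h hp)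

theorem AreSides.exists_mem_left {e f g : Sym2 Plane} (h : AreSides e f g) :
    ∃ p, p ∈ e ∧ p ∈ f := by
  obtain ⟨p, q, r, rfl, rfl, rfl⟩ := h
  exact ⟨q, by simp, by simp⟩

theorem AreSides.mem_pairs {e f g : Sym2 Plane} (h : AreSides e f g) (he : e ∈ pairs S)
    (hf : f ∈ pairs S) (hg : ¬ g.IsDiag) : g ∈ pairs S := by
  obtain ⟨p, q, r, rfl, rfl, rfl⟩ := h
  exact mk_mem_pairs.2 ⟨hg, (mk_mem_pairs.1 he).2.1, (mk_mem_pairs.1 hf).2.2⟩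

/-! ### Regions for freely placed sets -/

namespace PlacedFreely

theorem symm (h : PlacedFreely S T) : PlacedFreely T S where
  disjoint := h.disjoint.symm
  no_new_parallel e he f hf hne h1 h2 := by
    rw [Set.union_comm] at he hf
    exact h.no_new_parallel e he f hf hne h2 h1
  no_new_incidence e he f hf g hg hef hfg heg h1 h2 := by
    rw [Set.union_comm] at he hf hg
    exact h.no_new_incidence e he f hf g hg hef hfg heg h2 h1

/-- Concurrence would make the three pairs sides of a triangle; when two sides have their endpoints
in `S`, so does the third. -/
theorem not_concurrent_of_pairs_left (h : PlacedFreely S T) {e f g : Sym2 Plane} {V : Plane}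
    (he : e ∈ pairs S) (hf : f ∈ pairs S) (hef : e ≠ f) (hg : g ∈ pairs (S ∪ T))
    (hgS : g ∉ pairs S) (hVe : V ∈ bisector e) (hVf : V ∈ bisector f) : V ∉ bisector g := by
  intro hVg
  have hmono : pairs S ⊆ pairs (S ∪ T) := pairs_mono Set.subset_union_left
  refine hgS ((h.no_new_incidence e (hmono he) f (hmono hf) g hg hef ?_ ?_ ?_ ?_
    ⟨V, hVe, hVf, hVg⟩).mem_pairs he hf hg.1)
  · rintro rfl; exact hgS hf
  · rintro rfl; exact hgS he
  · exact fun h => hgS h.2.2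
  · exact fun hT => Set.disjoint_left.1 (disjoint_pairs h.disjoint) he hT.1

/-- Any two sides of a triangle share a vertex, so the exception in the incidence condition cannot
apply when `e` and `f` are disjoint. -/
theorem not_concurrent_of_disjoint (h : PlacedFreely S T) {e f g : Sym2 Plane} {V : Plane}
    (he : e ∈ pairs (S ∪ T)) (hf : f ∈ pairs (S ∪ T)) (hg : g ∈ pairs (S ∪ T))
    (hef : ∀ p ∈ e, p ∉ f) (hfg : f ≠ g) (heg : e ≠ g)
    (h1 : ¬ (e ∈ pairs S ∧ f ∈ pairs S)) (h2 : ¬ (e ∈ pairs T ∧ f ∈ pairs T))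
    (hVe : V ∈ bisector e) (hVf : V ∈ bisector f) : V ∉ bisector g := by
  intro hVg
  have hne : e ≠ f := fun h' => hef _ e.out_fst_mem (h' ▸ e.out_fst_mem)
  obtain ⟨p, hp, hp'⟩ := (h.no_new_incidence e he f hf g hg hne hfg heg
    (fun h => h1 ⟨h.1, h.2.1⟩) (fun h => h2 ⟨h.1, h.2.1⟩) ⟨V, hVe, hVf, hVg⟩).exists_mem_left
  exact hef p hp hp'

theorem notMem_pairs_left (h : PlacedFreely S T) {p q : Plane} (hq : q ∈ T) :
    s(p, q) ∉ pairs S := fun h' =>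
  Set.disjoint_left.1 h.disjoint (mk_mem_pairs.1 h').2.2 hq

theorem notMem_pairs_right (h : PlacedFreely S T) {p q : Plane} (hp : p ∈ S) :
    s(p, q) ∉ pairs T := fun h' =>
  Set.disjoint_left.1 h.disjoint hp (mk_mem_pairs.1 h').2.1

theorem mk_mem_pairs_union (h : PlacedFreely S T) {p q : Plane} (hp : p ∈ S) (hq : q ∈ T) :
    s(p, q) ∈ pairs (S ∪ T) := by
  rw [pairs_union _ _ h.disjoint]
  exact Or.inr ⟨(p, q), ⟨hp, hq⟩, rfl⟩

/-- Two different pairs in `T` have different bisectors. -/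
theorem exists_mem_bisector_notMem_right (h : PlacedFreely S T) (hS : S.Nonempty)
    {e g : Sym2 Plane} (he : e ∈ pairs T) (hg : g ∈ pairs T) (hne : e ≠ g) :
    ∃ V, V ∈ bisector g ∧ V ∉ bisector e := by
  obtain ⟨p, hp⟩ := hS
  have hq : e.out.1 ∈ T := he.2 _ e.out_fst_mem
  -- A mixed bisector serves as a probe: it meets the bisector of `g` in a point `V`. If `V` also
  -- lay on the bisector of `e`, two pairs in `T` and a mixed pair would be concurrent.
  have hc := h.mk_mem_pairs_union hp hq
  have hcT := h.notMem_pairs_right (q := e.out.1) hp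
  obtain ⟨V, hV⟩ := bisector_inter_eq_singleton hg.1 hc.1
    (h.no_new_parallel g (pairs_mono Set.subset_union_right hg) _ hc
      (fun h' => hcT (h' ▸ hg)) (fun h' => h.notMem_pairs_left hq h'.2) (fun h' => hcT h'.2))
  have hV' : V ∈ (bisector g : Set Plane) ∩ bisector s(p, e.out.1) := by rw [hV]; rfl
  refine ⟨V, hV'.1, fun hVe => ?_⟩
  exact h.symm.not_concurrent_of_pairs_left he hg hne (Set.union_comm S T ▸ hc) hcT hVe hV'.1 hV'.2

/-- When a bisector of `T` is added, its crossings with `S` are all different and avoid its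
crossings with `T`, so it gains `(pairs S).ncard` more regions than it would without `S`. The `+ 1`
corrects for the undivided plane being counted on both sides. -/
theorem numRegions_union_pairs (h : PlacedFreely S T) (hS : S.Finite) (hT : T.Finite) :
    numRegions (pairs S ∪ pairs T) + 1 =
      numRegions (pairs S) + numRegions (pairs T) + (pairs S).ncard * (pairs T).ncard := by
  -- The case of empty `S` is separate because distinctness of the bisectors within `T` is derived
  -- from a point of `S`.
  rcases S.eq_empty_or_nonempty with rfl | hne
  · have h0 : pairs ∅ = ∅ := by
      ext e
      simp only [Set.mem_empty_iff_false, iff_false]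
      exact fun he => (he.2 _ e.out_fst_mem).elim
    rw [h0, Set.empty_union, numRegions_empty, Set.ncard_empty]
    ring
  have hdisj := Set.disjoint_left.1 (disjoint_pairs h.disjoint)
  have hAfin := pairs_finite hS
  have hl : pairs S ⊆ pairs (S ∪ T) := pairs_mono Set.subset_union_left
  have hr : pairs T ⊆ pairs (S ∪ T) := pairs_mono Set.subset_union_right
  suffices H : ∀ B : Set (Sym2 Plane), B.Finite → B ⊆ pairs T →
      numRegions (pairs S ∪ B) + 1 =
        numRegions (pairs S) + numRegions B + (pairs S).ncard * B.ncard from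
    H _ (pairs_finite hT) subset_rfl
  intro B hB
  induction B, hB using Set.Finite.induction_on with
  | empty =>
    intro _
    simp [numRegions_empty]
  | @insert g B hgB hB ih =>
    intro hsub
    have hgT : g ∈ pairs T := hsub (Set.mem_insert _ _)
    have hBT : B ⊆ pairs T := (Set.subset_insert _ _).trans hsub
    have hgS : g ∉ pairs S := fun h' => hdisj h' hgT
    have hpar : ∀ e ∈ pairs S, ¬ bisector g ∥ bisector e := fun e he =>
      h.no_new_parallel g (hr hgT) e (hl he) (fun h' => hgS (h' ▸ he)) (fun h' => hgS h'.1)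
        (fun h' => hdisj he h'.2)
    have hexS : ∀ e ∈ pairs S, ∃ V, V ∈ bisector g ∧ V ∉ bisector e := fun e he =>
      exists_mem_bisector_notMem hgT.1 he.1 (hpar e he)
    have hexB : ∀ e ∈ B, ∃ V, V ∈ bisector g ∧ V ∉ bisector e := fun e he =>
      h.exists_mem_bisector_notMem_right hne (hBT he) hgT (fun h' => hgB (h' ▸ he))
    have hgen : (crossings (fun e => bisectorForm e) g (pairs S)).ncard = (pairs S).ncard := by
      refine ncard_crossings_of_generic hgT.1 (fun e he => he.1) hpar ?_
      rintro e he f hf hef ⟨V, hVg, hVe, hVf⟩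
      exact h.not_concurrent_of_pairs_left he hf hef (hr hgT) hgS hVe hVf hVg
    have hun : crossings (fun e => bisectorForm e) g (pairs S ∪ B) =
        crossings (fun e => bisectorForm e) g (pairs S) ∪
          crossings (fun e => bisectorForm e) g B := by
      ext V
      simp only [Set.mem_union, mem_crossings, or_and_right, exists_or, and_or_left]
    have hdisj' : Disjoint (crossings (fun e => bisectorForm e) g (pairs S))
        (crossings (fun e => bisectorForm e) g B) := by
      rw [Set.disjoint_left]
      intro V hV hV'
      obtain ⟨hVg, e, he, hVe⟩ := mem_crossings.1 hV
      obtain ⟨-, f, hf, hVf⟩ := mem_crossings.1 hV'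
      exact h.symm.not_concurrent_of_pairs_left (hBT hf) hgT (fun h' => hgB (h' ▸ hf))
        (Set.union_comm S T ▸ hl he) (fun h' => hdisj he h') hVf hVg hVe
    have h1 := numRegions_insert hB hgB hgT.1 hexB
    have h2 := numRegions_insert (hAfin.union hB) (g := g) (by simp [hgS, hgB]) hgT.1
      (by rintro e (he | he); exacts [hexS e he, hexB e he])
    rw [hun, Set.ncard_union_eq hdisj' (crossings_finite hAfin hgT.1 hexS)
      (crossings_finite hB hgT.1 hexB), hgen] at h2
    rw [Set.union_insert, h2, h1, Set.ncard_insert_of_notMem hgB hB]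
    have := ih hBT
    linarith

/-- The number of new points on the bisector of a mixed pair when it is added to the bisectors of
the pairs in `S`, the pairs in `T` and the mixed pairs in `C`. -/
theorem ncard_crossings_mixed (h : PlacedFreely S T) (hS : S.Finite) (hT : T.Finite)
    {C : Set (Plane × Plane)} (hC : C ⊆ S ×ˢ T) {c : Plane × Plane} (hc : c ∈ S ×ˢ T) (hcC : c ∉ C) :
    (crossings (fun e => bisectorForm e) (unorderedPair c)
      (pairs S ∪ pairs T ∪ unorderedPair '' C)).ncard =
      (pairs S).ncard + (pairs T).ncard + {x | x ∈ C ∧ c.1 ≠ x.1 ∧ c.2 ≠ x.2}.ncard := by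
  set C' := {x | x ∈ C ∧ c.1 ≠ x.1 ∧ c.2 ≠ x.2} with hC'
  have hC'sub : C' ⊆ S ×ˢ T := fun x hx => hC hx.1
  have hfin : (S ×ˢ T).Finite := hS.prod hT
  have hl : pairs S ⊆ pairs (S ∪ T) := pairs_mono Set.subset_union_left
  have hr : pairs T ⊆ pairs (S ∪ T) := pairs_mono Set.subset_union_right
  have hm : ∀ x ∈ S ×ˢ T, unorderedPair x ∈ pairs (S ∪ T) := fun x hx =>
    h.mk_mem_pairs_union hx.1 hx.2
  have hmS : ∀ x ∈ S ×ˢ T, unorderedPair x ∉ pairs S := fun x hx => h.notMem_pairs_left hx.2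
  have hmT : ∀ x ∈ S ×ˢ T, unorderedPair x ∉ pairs T := fun x hx => h.notMem_pairs_right hx.1
  have hdisj := Set.disjoint_left.1 (disjoint_pairs h.disjoint)
  have hshare : ∀ x ∈ C', ∀ p ∈ unorderedPair c, p ∉ unorderedPair x := by
    intro x hx p hp hp'
    have hx' := hC'sub hx
    rcases Sym2.mem_iff.1 hp with rfl | rfl <;> rcases Sym2.mem_iff.1 hp' with h1 | h1
    · exact hx.2.1 h1
    · exact Set.disjoint_left.1 h.disjoint hc.1 (h1 ▸ hx'.2)
    · exact Set.disjoint_left.1 h.disjoint hx'.1 (h1 ▸ hc.2)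
    · exact hx.2.2 h1
  -- If `x` and `c` share an endpoint, a common point of their bisectors is equidistant from three
  -- points, two of them on the same side. It therefore lies on a bisector within `S` or `T` and is
  -- already counted.
  have hreduce : crossings (fun e => bisectorForm e) (unorderedPair c)
      (pairs S ∪ pairs T ∪ unorderedPair '' C) =
      crossings (fun e => bisectorForm e) (unorderedPair c)
      (pairs S ∪ pairs T ∪ unorderedPair '' C') := by
    ext V
    rw [mem_crossings, mem_crossings]
    refine and_congr_right fun hV => ⟨?_, ?_⟩
    · rintro ⟨e, he | ⟨x, hx, rfl⟩, hVe⟩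
      · exact ⟨e, Or.inl he, hVe⟩
      · have hV1 : dist V c.1 = dist V c.2 := mem_bisector_mk.1 hV
        have hV2 : dist V x.1 = dist V x.2 := mem_bisector_mk.1 hVe
        by_cases h1 : c.1 = x.1
        · have h2 : c.2 ≠ x.2 := fun h2 => hcC (Prod.ext h1 h2 ▸ hx)
          refine ⟨s(c.2, x.2), Or.inl (Or.inr (mk_mem_pairs.2 ⟨h2, hc.2, (hC hx).2⟩)),
            mem_bisector_mk.2 ?_⟩
          rw [← hV1, ← hV2, h1]
        · by_cases h2 : c.2 = x.2
          · refine ⟨s(c.1, x.1), Or.inl (Or.inl (mk_mem_pairs.2 ⟨h1, hc.1, (hC hx).1⟩)),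
              mem_bisector_mk.2 ?_⟩
            rw [hV1, hV2, h2]
          · exact ⟨_, Or.inr ⟨x, ⟨hx, h1, h2⟩, rfl⟩, hVe⟩
    · rintro ⟨e, he | ⟨x, hx, rfl⟩, hVe⟩
      · exact ⟨e, Or.inl he, hVe⟩
      · exact ⟨_, Or.inr ⟨x, hx.1, rfl⟩, hVe⟩
  have hsub : pairs S ∪ pairs T ∪ unorderedPair '' C' ⊆ pairs (S ∪ T) := by
    rintro e ((he | he) | ⟨x, hx, rfl⟩)
    exacts [hl he, hr he, hm x (hC'sub hx)]
  have hcne : ∀ e ∈ pairs S ∪ pairs T ∪ unorderedPair '' C', unorderedPair c ≠ e := by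
    rintro e ((he | he) | ⟨x, hx, rfl⟩) h'
    · exact hmS c hc (h' ▸ he)
    · exact hmT c hc (h' ▸ he)
    · exact hx.2.1 (congrArg Prod.fst (injOn_unorderedPair h.disjoint hc (hC'sub hx) h'))
  have hST : ∀ e ∈ pairs S, ∀ f ∈ pairs T, ∀ p ∈ e, p ∉ f := fun e he f hf p hp hp' =>
    Set.disjoint_left.1 h.disjoint (he.2 p hp) (hf.2 p hp')
  have hmix : ∀ x ∈ C', ∀ f ∈ pairs S ∪ pairs T ∪ unorderedPair '' C', unorderedPair x ≠ f →
      ∀ V ∈ bisector (unorderedPair c), V ∈ bisector (unorderedPair x) → V ∉ bisector f :=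
    fun x hx f hf hxf V hVc hVx =>
      h.not_concurrent_of_disjoint (hm c hc) (hm x (hC'sub hx)) (hsub hf) (hshare x hx) hxf
        (hcne f hf) (fun h' => hmS c hc h'.1) (fun h' => hmT c hc h'.1) hVc hVx
  have hSTc : ∀ e ∈ pairs S, ∀ f ∈ pairs T, ∀ V ∈ bisector (unorderedPair c), V ∈ bisector e →
      V ∉ bisector f := fun e he f hf V hVc hVe hVf =>
    h.not_concurrent_of_disjoint (hl he) (hr hf) (hm c hc) (hST e he f hf)
      (hcne f (Or.inl (Or.inr hf))).symm (hcne e (Or.inl (Or.inl he))).symm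
      (fun h' => hdisj h'.2 hf) (fun h' => hdisj he h'.1) hVe hVf hVc
  rw [hreduce, ncard_crossings_of_generic (hm c hc).1 (fun e he => (hsub he).1)]
  · have hCfin : C'.Finite := hfin.subset hC'sub
    rw [Set.ncard_union_eq _ ((pairs_finite hS).union (pairs_finite hT)) (hCfin.image _),
      Set.ncard_union_eq (disjoint_pairs h.disjoint) (pairs_finite hS) (pairs_finite hT),
      ((injOn_unorderedPair h.disjoint).mono hC'sub).ncard_image]
    rw [Set.disjoint_left]
    rintro e he ⟨x, hx, rfl⟩
    exact he.elim (hmS x (hC'sub hx)) (hmT x (hC'sub hx))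
  · exact fun e he => h.no_new_parallel _ (hm c hc) e (hsub he) (hcne e he)
      (fun h' => hmS c hc h'.1) (fun h' => hmT c hc h'.1)
  · rintro e he f hf hef ⟨V, hVc, hVe, hVf⟩
    rcases he with (he | he) | ⟨x, hx, rfl⟩
    · rcases hf with (hf | hf) | ⟨y, hy, rfl⟩
      · exact h.not_concurrent_of_pairs_left he hf hef (hm c hc) (hmS c hc) hVe hVf hVc
      · exact hSTc e he f hf V hVc hVe hVf
      · exact hmix y hy e (Or.inl (Or.inl he)) hef.symm V hVc hVf hVe
    · rcases hf with (hf | hf) | ⟨y, hy, rfl⟩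
      · exact hSTc f hf e he V hVc hVf hVe
      · exact h.symm.not_concurrent_of_pairs_left he hf hef (Set.union_comm S T ▸ hm c hc)
          (hmT c hc) hVe hVf hVc
      · exact hmix y hy e (Or.inl (Or.inr he)) hef.symm V hVc hVf hVe
    · exact hmix x hx f hf hef V hVc hVe hVf

open scoped Classical in
-- Each couple of disjoint mixed pairs contributes once, when its later member is added. The double
-- sum sees it in both orders, hence the doubling, which also makes the count independent of the
-- order of insertion.
theorem numRegions_union_mixed (h : PlacedFreely S T) (hS : S.Finite) (hT : T.Finite)
    (C : Finset (Plane × Plane)) (hC : (C : Set (Plane × Plane)) ⊆ S ×ˢ T) :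
    2 * numRegions (pairs S ∪ pairs T ∪ unorderedPair '' C) =
      2 * numRegions (pairs S ∪ pairs T) +
        2 * (C.card * ((pairs S).ncard + (pairs T).ncard + 1)) +
        ∑ x ∈ C, ∑ y ∈ C, if x.1 ≠ y.1 ∧ x.2 ≠ y.2 then 1 else 0 := by
  induction C using Finset.induction_on with
  | empty => simp
  | insert c C hcC ih =>
    rw [Finset.coe_insert, Set.insert_subset_iff] at hC
    obtain ⟨hc, hC⟩ := hC
    have hm : ∀ x ∈ S ×ˢ T, unorderedPair x ∈ pairs (S ∪ T) := fun x hx =>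
      h.mk_mem_pairs_union hx.1 hx.2
    have hcn : unorderedPair c ∉ pairs S ∪ pairs T ∪ unorderedPair '' C := by
      rintro ((h' | h') | ⟨x, hx, hxc⟩)
      · exact h.notMem_pairs_left hc.2 h'
      · exact h.notMem_pairs_right hc.1 h'
      · exact hcC (injOn_unorderedPair h.disjoint (hC hx) hc hxc ▸ hx)
    have hsub : pairs S ∪ pairs T ∪ unorderedPair '' C ⊆ pairs (S ∪ T) := by
      rintro e ((he | he) | ⟨x, hx, rfl⟩)
      exacts [pairs_mono Set.subset_union_left he, pairs_mono Set.subset_union_right he,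
        hm x (hC hx)]
    have hins := numRegions_insert (((pairs_finite hS).union (pairs_finite hT)).union
      (C.finite_toSet.image unorderedPair)) hcn (hm c hc).1 (fun e he =>
        exists_mem_bisector_notMem (hm c hc).1 (hsub he).1
          (h.no_new_parallel _ (hm c hc) e (hsub he) (fun h' => hcn (h' ▸ he))
            (fun h' => h.notMem_pairs_left hc.2 h'.1)
            (fun h' => h.notMem_pairs_right hc.1 h'.1)))
    have hcard : {x | x ∈ (C : Set (Plane × Plane)) ∧ c.1 ≠ x.1 ∧ c.2 ≠ x.2}.ncard =
        ∑ y ∈ C, if c.1 ≠ y.1 ∧ c.2 ≠ y.2 then 1 else 0 := by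
      rw [← Finset.card_filter, ← Set.ncard_coe_finset]
      congr 1
      ext x
      simp
    rw [h.ncard_crossings_mixed hS hT hC hc hcC, hcard] at hins
    have hsymm : (∑ x ∈ C, if x.1 ≠ c.1 ∧ x.2 ≠ c.2 then 1 else 0) =
        ∑ y ∈ C, if c.1 ≠ y.1 ∧ c.2 ≠ y.2 then 1 else 0 :=
      Finset.sum_congr rfl fun x _ => by simp only [ne_comm]
    have hsum : (∑ x ∈ insert c C, ∑ y ∈ insert c C, if x.1 ≠ y.1 ∧ x.2 ≠ y.2 then 1 else 0) =
        2 * (∑ y ∈ C, if c.1 ≠ y.1 ∧ c.2 ≠ y.2 then 1 else 0) +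
          ∑ x ∈ C, ∑ y ∈ C, if x.1 ≠ y.1 ∧ x.2 ≠ y.2 then 1 else 0 := by
      simp only [Finset.sum_insert hcC, Finset.sum_add_distrib, hsymm]
      simp only [ne_eq, not_true_eq_false, false_and, if_false]
      ring
    rw [Finset.coe_insert, Set.image_insert_eq, Set.union_insert, hins, hsum,
      Finset.card_insert_of_notMem hcC]
    have := ih hC
    linarith

end PlacedFreely

/-! ### Evaluation of the count -/

open scoped Classical in
theorem sum_ne_and_ne (S T : Finset Plane) :
    (∑ x ∈ S ×ˢ T, ∑ y ∈ S ×ˢ T, if x.1 ≠ y.1 ∧ x.2 ≠ y.2 then 1 else 0) =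
      S.card * T.card * ((S.card - 1) * (T.card - 1)) := by
  rw [← Finset.card_product, ← smul_eq_mul, ← Finset.sum_const]
  refine Finset.sum_congr rfl fun x hx => ?_
  rw [Finset.mem_product] at hx
  rw [← Finset.card_filter, ← Finset.card_erase_of_mem hx.1, ← Finset.card_erase_of_mem hx.2,
    ← Finset.card_product]
  congr 1
  ext y
  simp only [Finset.mem_filter, Finset.mem_product, Finset.mem_erase]
  tauto

end Pairs

theorem lemmaL (S T : Set Plane) (hS : S.Finite) (hT : T.Finite) (s t : ℕ)
    (hs : S.ncard = s) (ht : T.ncard = t) (hfree : PlacedFreely S T) :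
    (numOrderings (S ∪ T) : ℚ) = numOrderings S + numOrderings T +
      (3 * (s : ℚ) ^ 2 * (t : ℚ) ^ 2 + 2 * (s : ℚ) ^ 3 * t - 5 * (s : ℚ) ^ 2 * t
        + 2 * (s : ℚ) * (t : ℚ) ^ 3 - 5 * (s : ℚ) * (t : ℚ) ^ 2 + 7 * (s : ℚ) * t - 4) / 4 := by
  classical
  rw [numOrderings_eq_numRegions, numOrderings_eq_numRegions, numOrderings_eq_numRegions,
    pairs_union S T hfree.disjoint]
  have h1 := hfree.numRegions_union_pairs hS hT
  have hcoe : ((hS.toFinset ×ˢ hT.toFinset : Finset (Plane × Plane)) : Set (Plane × Plane)) =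
      S ×ˢ T := by simp
  have h2 := hfree.numRegions_union_mixed hS hT (hS.toFinset ×ˢ hT.toFinset) hcoe.subset
  rw [hcoe, sum_ne_and_ne, Finset.card_product, ← Set.ncard_eq_toFinset_card S hS,
    ← Set.ncard_eq_toFinset_card T hT, hs, ht] at h2
  rw [ncard_pairs hS, ncard_pairs hT, hs, ht] at h1 h2
  -- The factor `n` makes truncated subtraction harmless at `n = 0`.
  have hmul : ∀ n : ℕ, (n : ℚ) * ((n - 1 : ℕ) : ℚ) = n * (n - 1) := by
    rintro (_ | n) <;> simp
  have h3 : ((s * t * ((s - 1) * (t - 1)) : ℕ) : ℚ) = s * (s - 1) * (t * (t - 1)) := by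
    rw [← hmul, ← hmul]
    push_cast
    ring
  have h1' := congrArg (Nat.cast (R := ℚ)) h1
  have h2' := congrArg (Nat.cast (R := ℚ)) h2
  rw [Nat.cast_add _ (s * t * _), h3] at h2'
  push_cast [Nat.cast_choose_two] at h1' h2'
  linear_combination h2' / 2 + h1'
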